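/- Let $K, M, D, \ell, t$ be positive integers with $\ell \le D$ such that $n = (D-\ell)/t + 1$ is an integer, and assume $Kn \ge 2$. Let $w_{i,m} \in \mathbb{R}^{\ell}$, $1\le i\le K$, $1\le m\le M$, be random vectors whose $KM\ell$ entries are i.i.d. sub-Gaussian random variables $X$ with mean zero and unit variance, where sub-Gaussian with parameter $c$ means $\mathbb{E}\, e^{sX} \le e^{c s^2/2}$ for all $s \in \mathbb{R}$ (for instance standard Gaussian, with $c = 1$). Let $W$ be the $Kn \times MD$ weight matrix of the single-layer CNN with $M$ channels, input length $D$ and stride $t$ whose filters are the scaled vectors $\frac{1}{\sqrt{M\ell}} w_{i,m}$: the rows of $W$ form $K$ blocks of $n$ rows, and for $1\le i\le K$ and $0 \le j \le n-1$ the $(i,j)$-th row is the concatenation over $m = 1,\dots,M$ of the vectors in $\mathbb{R}^D$ that carry $\frac{1}{\sqrt{M\ell}} w_{i,m}$ in positions $jt+1,\dots,jt+\ell$ and are zero elsewhere. For $k \ge 0$ let $\mathcal{M}_k \subset \mathbb{R}^{Kn}$ be the set of vectors with at most $k$ nonzero entries in total and at most one nonzero entry in each of the $K$ consecutive blocks of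 length $n$. For every $c$ there is a constant $C > 0$, depending only on $c$ (hence absolute in the Gaussian case), such that for all such $K, M, D, \ell, t, n$ and filters with parameter $c$, all $k$, all $\delta_k \in (0,1)$ and all $\epsilon \in (0,1)$: if $$\frac{M\ell^2}{D} \;\ge\; \frac{C}{\delta_k^2}\Big(k\big(\log K + \log n\big) - \log \epsilon\Big),$$ then with probability at least $1-\epsilon$ the $MD \times Kn$ matrix $W^T$ satisfies the model-RIP for $\mathcal{M}_k$ with parameter $\delta_k$, that is, $$(1-\delta_k)\|z\|_2^2 \;\le\; \|W^T z\|_2^2 \;\le\; (1+\delta_k)\|z\|_2^2 \qquad \text{for all } z \in \mathcal{M}_k .$$ -/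

import Mathlib

open MeasureTheory ProbabilityTheory
open scoped NNReal Matrix

/-- The `Kn × MD` weight matrix of a one-dimensional single layer CNN with filter bank `f`
(`K` filters of length `ℓ` in each of `M` channels), input length `D`, stride `t` and `n` shifts.
The row `(i, j)` is the concatenation over the channels `m` of the `i`-th filter of channel `m`
shifted by `j * t` and padded with zeros: its entry at position `j * t + a` is `f i m a`.
Rows are grouped into `K` blocks (index `i`) of `n` shifts (index `j`). -/
def cnnMatrix {K M ℓ : ℕ} (n D t : ℕ) (f : Fin K → Fin M → Fin ℓ → ℝ) :
    Matrix (Fin K × Fin n) (Fin M × Fin D) ℝ :=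
  fun r s =>
    if h : r.2.val * t ≤ s.2.val ∧ s.2.val - r.2.val * t < ℓ then
      f r.1 s.1 ⟨s.2.val - r.2.val * t, h.2⟩
    else 0

/-- The model `𝓜_k` of model-`k`-sparse vectors in `ℝ^{Kn}`: at most one nonzero entry in each of
the `K` blocks of length `n`, and at most `k` nonzero entries in total. -/
def modelSparse (K n k : ℕ) : Set (EuclideanSpace ℝ (Fin K × Fin n)) :=
  {z | (∀ i : Fin K, ∀ j j' : Fin n, z (i, j) ≠ 0 → z (i, j') ≠ 0 → j = j') ∧
    {p : Fin K × Fin n | z p ≠ 0}.ncard ≤ k}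

/-- The model restricted isometry property of `Φ` for the model `𝓜_k` with distortion `δ`
(all norms are Euclidean). -/
def ModelRIP {ι : Type*} [Fintype ι] {K n : ℕ} (Φ : Matrix ι (Fin K × Fin n) ℝ)
    (k : ℕ) (δ : ℝ) : Prop :=
  ∀ z ∈ modelSparse K n k,
    (1 - δ) * ‖z‖ ^ 2 ≤ ‖WithLp.toLp 2 (Φ *ᵥ z.ofLp)‖ ^ 2 ∧
      ‖WithLp.toLp 2 (Φ *ᵥ z.ofLp)‖ ^ 2 ≤ (1 + δ) * ‖z‖ ^ 2

/-!
For `z` in the model, at most one shift of every filter enters `Wᵀ z`. Hence each filter entry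
contributes to exactly one coordinate of `Wᵀ z`, and these `M D` coordinates are independent
sub-Gaussian variables with parameter at most `b ‖z‖² / (M ℓ)`, where `b = max c 1`. Their squares
have total mean `‖z‖²`. The square of a sub-Gaussian variable, once centred, is sub-exponential
(`mgf_sq_sub_le_of_hasSubgaussianMGF`, by decoupling with an auxiliary Gaussian variable), so a
Chernoff bound gives Bernstein's inequality (`measure_abs_sum_sq_sub_ge_le`): with
`R = M ℓ² / D`, the inequality `|‖Wᵀ z‖² - ‖z‖²| ≤ η ‖z‖²` fails with probability at most
`2 exp (-η² R / (1024 b²))` (`measure_rip_fails_le`).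

The passage to all of the model is a covering argument. The model is a union of at most `(K n) ^ k`
subspaces of dimension at most `k`; the unit ball of each has a `1/4`-net of at most `25 ^ k`
points (`exists_quarter_net_closedBall`), and distortion `δ / 4` on the net forces distortion `δ`
on the subspace (`abs_norm_sq_sub_le_of_net`). Since `K n ≥ 2`, the factors `2` and `25 ^ k` in
the union bound are absorbed by the powers of `K n` when `k ≥ 1`; for `k = 0` the model is `{0}`.
-/

/-! ### Squares of sub-Gaussian variables -/

/-- The Taylor remainder of the exponential, with a bound that is global in `u`. -/
lemma Real.exp_le_one_add_add_sq_mul_exp_abs (u : ℝ) :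
    Real.exp u ≤ 1 + u + u ^ 2 * Real.exp |u| := by
  have h := Complex.norm_exp_sub_sum_le_norm_mul_exp (u : ℂ) 2
  rw [Complex.norm_real, Real.norm_eq_abs, sq_abs] at h
  have h2 : Complex.exp u - ∑ m ∈ Finset.range 2, (u : ℂ) ^ m / m.factorial
      = ((Real.exp u - (1 + u) : ℝ) : ℂ) := by
    simp [Finset.sum_range_succ]
  rw [h2, Complex.norm_real, Real.norm_eq_abs] at h
  linarith [(abs_le.1 h).2]

/-- For a standard Gaussian `g`, `E exp (g² / 4) = √2`. The integrand times the standard Gaussian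
density is `√2` times the density of variance `2`. -/
lemma lintegral_exp_sq_div_four_gaussianReal :
    ∫⁻ x, ENNReal.ofReal (Real.exp (x ^ 2 / 4)) ∂(gaussianReal 0 1)
      = ENNReal.ofReal (Real.sqrt 2) := by
  rw [gaussianReal_of_var_ne_zero 0 one_ne_zero,
    lintegral_withDensity_eq_lintegral_mul _ (measurable_gaussianPDF 0 1) (by fun_prop)]
  have h : ∀ x : ℝ, (gaussianPDF 0 1 * fun x => ENNReal.ofReal (Real.exp (x ^ 2 / 4))) x
      = ENNReal.ofReal (Real.sqrt 2) * gaussianPDF 0 2 x := by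
    intro x
    simp only [Pi.mul_apply, gaussianPDF_def]
    rw [← ENNReal.ofReal_mul (gaussianPDFReal_nonneg _ _ _), ← ENNReal.ofReal_mul (by positivity)]
    congr 1
    simp only [gaussianPDFReal_def, NNReal.coe_one, NNReal.coe_ofNat, sub_zero, mul_one]
    have h2 : Real.sqrt (2 * Real.pi * 2) = Real.sqrt (2 * Real.pi) * Real.sqrt 2 :=
      Real.sqrt_mul (by positivity) _
    have h3 : Real.sqrt 2 ≠ 0 := by positivity
    rw [h2, mul_inv, mul_assoc, ← Real.exp_add]
    rw [show -x ^ 2 / 2 + x ^ 2 / 4 = -x ^ 2 / (2 * 2) by ring]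
    field_simp
  rw [lintegral_congr h, lintegral_const_mul _ (measurable_gaussianPDF 0 2),
    lintegral_gaussianPDF_eq_one 0 two_ne_zero, mul_one]

lemma hasSubgaussianMGF_mono {Ω : Type*} [MeasurableSpace Ω] {P : Measure Ω} {Y : Ω → ℝ}
    {a b : ℝ≥0} (h : HasSubgaussianMGF Y a P) (hab : a ≤ b) :
    HasSubgaussianMGF Y b P where
  integrable_exp_mul := h.integrable_exp_mul
  mgf_le t := (h.mgf_le t).trans <| by
    have : (a : ℝ) ≤ b := hab
    gcongr

section Square

variable {Ω : Type*} [MeasurableSpace Ω] {P : Measure Ω} [IsProbabilityMeasure P] {Y : Ω → ℝ}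

/-- Decoupling: `exp (y² / (4σ))` is the average of `exp (g y / √(2σ))` over a standard Gaussian
`g`, so that the moment generating function of `Y` bounds the exponential moment of `Y²`. -/
lemma lintegral_exp_sq_le_of_hasSubgaussianMGF {σ : ℝ≥0} (hσ : 0 < σ)
    (h : HasSubgaussianMGF Y σ P) :
    ∫⁻ ω, ENNReal.ofReal (Real.exp (Y ω ^ 2 / (4 * σ))) ∂P ≤ ENNReal.ofReal (Real.sqrt 2) := by
  have hσ' : (0 : ℝ) < σ := hσ
  set q : ℝ := Real.sqrt (2 * σ) with hq
  have hq0 : 0 < q := by positivity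
  have hq2 : q ^ 2 = 2 * σ := Real.sq_sqrt (by positivity)
  have hgauss : ∀ y : ℝ, ENNReal.ofReal (Real.exp (y ^ 2 / (4 * σ)))
      = ∫⁻ x, ENNReal.ofReal (Real.exp (y / q * x)) ∂(gaussianReal 0 1) := by
    intro y
    rw [← ofReal_integral_eq_lintegral_ofReal (integrable_exp_mul_gaussianReal _)
      (ae_of_all _ fun _ => (Real.exp_pos _).le)]
    have := congrFun (mgf_id_gaussianReal (μ := 0) (v := 1)) (y / q)
    simp only [mgf, id] at this
    rw [this]
    congr 2
    rw [div_pow, hq2]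
    push_cast
    field_simp
    ring
  simp_rw [hgauss]
  have hYm := h.aemeasurable
  rw [lintegral_lintegral_swap]
  · rw [← lintegral_exp_sq_div_four_gaussianReal]
    refine lintegral_mono fun x => ?_
    have h1 : ∀ ω, Real.exp (Y ω / q * x) = Real.exp (x / q * Y ω) := fun ω => by
      congr 1; ring
    simp_rw [h1]
    rw [← ofReal_integral_eq_lintegral_ofReal (h.integrable_exp_mul _)
      (ae_of_all _ fun _ => (Real.exp_pos _).le)]
    refine ENNReal.ofReal_le_ofReal ((h.mgf_le _).trans_eq ?_)
    congr 1
    rw [div_pow, hq2]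
    field_simp
    ring
  · apply AEMeasurable.ennreal_ofReal
    apply Real.measurable_exp.comp_aemeasurable
    exact (hYm.comp_fst.div_const q).mul measurable_snd.aemeasurable

lemma integrable_exp_sq_of_hasSubgaussianMGF {σ : ℝ≥0} (hσ : 0 < σ)
    (h : HasSubgaussianMGF Y σ P) :
    Integrable (fun ω => Real.exp (Y ω ^ 2 / (4 * σ))) P ∧
      ∫ ω, Real.exp (Y ω ^ 2 / (4 * σ)) ∂P ≤ Real.sqrt 2 := by
  have hle := lintegral_exp_sq_le_of_hasSubgaussianMGF hσ h
  have hYm := h.aemeasurable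
  have hm : AEStronglyMeasurable (fun ω => Real.exp (Y ω ^ 2 / (4 * σ))) P :=
    AEMeasurable.aestronglyMeasurable (by fun_prop)
  have hint : Integrable (fun ω => Real.exp (Y ω ^ 2 / (4 * σ))) P := by
    refine ⟨hm, ?_⟩
    rw [hasFiniteIntegral_iff_ofReal (ae_of_all _ fun _ => (Real.exp_pos _).le)]
    exact hle.trans_lt ENNReal.ofReal_lt_top
  refine ⟨hint, ?_⟩
  rw [← ofReal_integral_eq_lintegral_ofReal hint (ae_of_all _ fun _ => (Real.exp_pos _).le)] at hle
  exact (ENNReal.ofReal_le_ofReal_iff (by positivity)).1 hle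

/-- The centred square of a sub-Gaussian variable is sub-exponential. -/
lemma mgf_sq_sub_le_of_hasSubgaussianMGF {σ : ℝ≥0} (hσ : 0 < σ) (h : HasSubgaussianMGF Y σ P)
    {τ : ℝ} (hτ : ∫ ω, Y ω ^ 2 ∂P = τ) (hτσ : τ ≤ σ) {s : ℝ} (hs : |s| * σ ≤ 1 / 8) :
    Integrable (fun ω => Real.exp (s * (Y ω ^ 2 - τ))) P ∧
      mgf (fun ω => Y ω ^ 2 - τ) P s ≤ Real.exp (256 * (s * σ) ^ 2) := by
  have hσ' : (0 : ℝ) < σ := hσ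
  obtain ⟨hint, hbd⟩ := integrable_exp_sq_of_hasSubgaussianMGF hσ h
  have hτ0 : 0 ≤ τ := hτ ▸ integral_nonneg fun _ => sq_nonneg _
  have hYm := h.aemeasurable
  have hY2 : Integrable (fun ω => Y ω ^ 2) P := (h.memLp 2).integrable_sq
  have hexp : Real.exp (1 / 4) * Real.sqrt 2 ≤ 2 := by
    have h1 : Real.exp (1 / 4) ≤ 4 / 3 := by
      have := Real.one_sub_le_exp_neg (1 / 4)
      rw [Real.exp_neg] at this
      rw [← inv_inv (Real.exp (1 / 4))]
      calc _ ≤ (1 - 1 / 4 : ℝ)⁻¹ := by gcongr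
        _ = 4 / 3 := by norm_num
    have h2 : Real.sqrt 2 ≤ 3 / 2 := by
      rw [Real.sqrt_le_left (by norm_num)]; norm_num
    calc _ ≤ (4 / 3 : ℝ) * (3 / 2) := by gcongr
      _ = 2 := by norm_num
  have hpt : ∀ ω, Real.exp (s * (Y ω ^ 2 - τ)) ≤ 1 + s * (Y ω ^ 2 - τ)
      + 128 * (s * σ) ^ 2 * (Real.exp (1 / 4) * Real.exp (Y ω ^ 2 / (4 * σ))) := by
    intro ω
    set y := Y ω ^ 2 with hy
    have hy0 : 0 ≤ y := sq_nonneg _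
    set a := |y - τ| / (8 * σ) with ha
    have ha0 : 0 ≤ a := by positivity
    have hu : |s * (y - τ)| ≤ a := by
      rw [abs_mul, ha, le_div_iff₀ (by positivity)]
      nlinarith [abs_nonneg (y - τ)]
    have hu2 : (s * (y - τ)) ^ 2 = 64 * (s * σ) ^ 2 * a ^ 2 := by
      rw [ha, div_pow, sq_abs]; field_simp; ring
    have ha2 : a ^ 2 ≤ 2 * Real.exp a := by
      have := Real.quadratic_le_exp_of_nonneg ha0
      nlinarith
    have hay : a + a ≤ 1 / 4 + y / (4 * σ) := by
      have h3 : |y - τ| ≤ y + σ := abs_le.2 ⟨by linarith, by linarith⟩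
      rw [ha, ← add_div, div_add_div _ _ (by norm_num) (by positivity),
        div_le_div_iff₀ (by positivity) (by positivity)]
      nlinarith
    have h4 := Real.exp_le_one_add_add_sq_mul_exp_abs (s * (y - τ))
    have h5 : (s * (y - τ)) ^ 2 * Real.exp |s * (y - τ)|
        ≤ 128 * (s * σ) ^ 2 * (Real.exp (1 / 4) * Real.exp (y / (4 * σ))) := by
      calc (s * (y - τ)) ^ 2 * Real.exp |s * (y - τ)|
          ≤ 64 * (s * σ) ^ 2 * (2 * Real.exp a) * Real.exp a := by
            rw [hu2]; gcongr
        _ = 128 * (s * σ) ^ 2 * Real.exp (a + a) := by rw [Real.exp_add]; ring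
        _ ≤ 128 * (s * σ) ^ 2 * Real.exp (1 / 4 + y / (4 * σ)) := by gcongr
        _ = _ := by rw [Real.exp_add]
    linarith
  have hi0 : Integrable (fun ω => s * (Y ω ^ 2 - τ)) P :=
    (hY2.sub (integrable_const τ)).const_mul s
  have hi1 : Integrable (fun ω => 1 + s * (Y ω ^ 2 - τ)) P := (integrable_const 1).add hi0
  have hi2 : Integrable (fun ω => 128 * (s * σ) ^ 2 *
      (Real.exp (1 / 4) * Real.exp (Y ω ^ 2 / (4 * σ)))) P :=
    (hint.const_mul _).const_mul _
  have hI : Integrable (fun ω => Real.exp (s * (Y ω ^ 2 - τ))) P :=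
    (hi1.add hi2).mono' (AEMeasurable.aestronglyMeasurable (by fun_prop))
      (ae_of_all _ fun ω => by
        rw [Real.norm_eq_abs, abs_of_pos (Real.exp_pos _)]; exact hpt ω)
  refine ⟨hI, ?_⟩
  calc mgf (fun ω => Y ω ^ 2 - τ) P s
      ≤ ∫ ω, (1 + s * (Y ω ^ 2 - τ)) + 128 * (s * σ) ^ 2 *
        (Real.exp (1 / 4) * Real.exp (Y ω ^ 2 / (4 * σ))) ∂P :=
        integral_mono hI (hi1.add hi2) hpt
    _ = 1 + 128 * (s * σ) ^ 2 *
        (Real.exp (1 / 4) * ∫ ω, Real.exp (Y ω ^ 2 / (4 * σ)) ∂P) := by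
        rw [integral_add hi1 hi2, integral_const_mul, integral_const_mul,
          integral_add (integrable_const 1) hi0, integral_const_mul, integral_sub hY2 (integrable_const τ), hτ]
        simp
    _ ≤ 1 + 128 * (s * σ) ^ 2 * 2 := by
        gcongr
        exact le_trans (by gcongr) hexp
    _ ≤ Real.exp (256 * (s * σ) ^ 2) := by
        have := Real.add_one_le_exp (256 * (s * σ) ^ 2)
        linarith

end Square

/-- A linear combination of independent centred variables of unit variance. -/
lemma integral_sq_sum_of_iIndepFun {Ω : Type*} [MeasurableSpace Ω] {P : Measure Ω}
    [IsProbabilityMeasure P] {ι : Type*} {w : ι → Ω → ℝ} (hw : iIndepFun w P) (hL2 : ∀ a, MemLp (w a) 2 P)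
    (h0 : ∀ a, ∫ ω, w a ω ∂P = 0) (h1 : ∀ a, variance (w a) P = 1) (α : ι → ℝ) (S : Finset ι) :
    ∫ ω, (∑ a ∈ S, α a * w a ω) ^ 2 ∂P = ∑ a ∈ S, α a ^ 2 := by
  have hL : ∀ a, MemLp (fun ω => α a * w a ω) 2 P := fun a => (hL2 a).const_mul _
  have hv := IndepFun.variance_sum (X := fun a ω => α a * w a ω) (s := S) (fun a _ => hL a)
    (fun a _ b _ hab => (hw.indepFun hab).comp (φ := fun x => α a * x) (ψ := fun x => α b * x)
      (by fun_prop) (by fun_prop))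
  have hsum : MemLp (∑ a ∈ S, fun ω => α a * w a ω) 2 P := memLp_finsetSum' _ fun a _ => hL a
  have hmean : ∫ ω, (∑ a ∈ S, fun ω => α a * w a ω) ω ∂P = 0 := by
    simp only [Finset.sum_apply]
    rw [integral_finsetSum _ fun a _ => (hL a).integrable (by norm_num)]
    simp [integral_const_mul, h0]
  rw [variance_of_integral_eq_zero hsum.aemeasurable hmean] at hv
  simpa [variance_const_mul, h1] using hv

/-! ### Quadratic forms in disjoint groups of independent variables -/

section Groups

variable {Ω : Type*} [MeasurableSpace Ω] {P : Measure Ω} [IsProbabilityMeasure P]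
  {ι κ : Type*} [Fintype ι] [DecidableEq κ] {w : ι → Ω → ℝ}

/-- Functions of disjoint groups of independent variables multiply under the moment generating
function. The groups are the fibres of `φ`. -/
lemma mgf_sum_fiber_of_iIndepFun (hw : iIndepFun w P) (hm : ∀ a, AEMeasurable (w a) P)
    (φ : ι → κ) (g : κ → (ι → ℝ) → ℝ) (hg : ∀ r, Measurable (g r))
    (hgφ : ∀ r x y, (∀ a, φ a = r → x a = y a) → g r x = g r y) (S : Finset κ) (s : ℝ)
    (hint : ∀ r, Integrable (fun ω => Real.exp (s * g r (fun a => w a ω))) P) :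
    Integrable (fun ω => Real.exp (s * ∑ r ∈ S, g r (fun a => w a ω))) P ∧
      mgf (fun ω => ∑ r ∈ S, g r (fun a => w a ω)) P s
        = ∏ r ∈ S, mgf (fun ω => g r (fun a => w a ω)) P s := by
  classical
  induction S using Finset.induction_on with
  | empty => simp [mgf]
  | insert r S hr ih =>
    -- a function of the variables with index in `T`, extended by zero to all indices
    let ext : (T : Finset ι) → (T → ℝ) → ι → ℝ := fun T x a => if h : a ∈ T then x ⟨a, h⟩ else 0
    have hext : ∀ T, Measurable (ext T) := by
      intro T
      refine measurable_pi_lambda _ fun a => ?_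
      by_cases h : a ∈ T
      · simpa [ext, h] using measurable_pi_apply (X := fun _ : T => ℝ) ⟨a, h⟩
      · simp [ext, h]
    let A : Finset ι := Finset.univ.filter fun a => φ a = r
    let B : Finset ι := Finset.univ.filter fun a => φ a ∈ S
    have hAB : Disjoint A B := by
      rw [Finset.disjoint_left]
      intro a ha hb
      simp only [A, B, Finset.mem_filter, Finset.mem_univ, true_and] at ha hb
      exact hr (ha ▸ hb)
    have hind := (hw.indepFun_finset₀ A B hAB hm).comp
      (φ := fun x => g r (ext A x)) (ψ := fun x => ∑ q ∈ S, g q (ext B x))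
      ((hg r).comp (hext A)) (Finset.measurable_sum _ fun q _ => (hg q).comp (hext B))
    have e1 : (fun x => g r (ext A x)) ∘ (fun ω (i : A) => w i ω)
        = fun ω => g r (fun a => w a ω) := by
      funext ω
      refine hgφ r _ _ fun a ha => ?_
      simp [ext, A, ha]
    have e2 : (fun x => ∑ q ∈ S, g q (ext B x)) ∘ (fun ω (i : B) => w i ω)
        = fun ω => ∑ q ∈ S, g q (fun a => w a ω) := by
      funext ω
      refine Finset.sum_congr rfl fun q hq => hgφ q _ _ fun a ha => ?_
      simp [ext, B, ha, hq]
    rw [e1, e2] at hind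
    have e3 : (fun ω => ∑ q ∈ insert r S, g q (fun a => w a ω))
        = (fun ω => g r (fun a => w a ω)) + fun ω => ∑ q ∈ S, g q (fun a => w a ω) := by
      funext ω
      simp [Finset.sum_insert hr]
    constructor
    · have := hind.integrable_exp_mul_add (hint r) ih.1
      simpa [Finset.sum_insert hr] using this
    · rw [e3, hind.mgf_add (hint r).aestronglyMeasurable ih.1.aestronglyMeasurable, ih.2,
        Finset.prod_insert hr]

/-- Bernstein's inequality for the squares of linear forms in disjoint groups of variables. The
groups are the fibres of `φ : ι → κ`, the linear forms have the coefficients `α`, and `σ` bounds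
the sub-Gaussian parameter of each form. The rate is governed by `1 / (card κ * σ ^ 2)`. -/
lemma measure_abs_sum_sq_sub_ge_le [Fintype κ] {c : ℝ≥0} (hw : iIndepFun w P)
    (hsub : ∀ a, HasSubgaussianMGF (w a) c P)
    (h0 : ∀ a, ∫ ω, w a ω ∂P = 0) (h1 : ∀ a, variance (w a) P = 1)
    (φ : ι → κ) (α : ι → ℝ) {σ : ℝ≥0} (hσ : 0 < σ)
    (hσ1 : ∀ r, ∑ a with φ a = r, α a ^ 2 ≤ σ) (hσc : ∀ r, (∑ a with φ a = r, α a ^ 2) * c ≤ σ)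
    {s η : ℝ} (hs0 : 0 ≤ s) (hs : s * σ ≤ 1 / 8) :
    P.real {ω | η ≤ |∑ r, (∑ a with φ a = r, α a * w a ω) ^ 2 - ∑ a, α a ^ 2|}
      ≤ 2 * Real.exp (-s * η + 256 * Fintype.card κ * (s * σ) ^ 2) := by
  have hm : ∀ a, AEMeasurable (w a) P := fun a => (hsub a).aemeasurable
  have hL2 : ∀ a, MemLp (w a) 2 P := fun a => (hsub a).memLp 2
  set v : κ → ℝ := fun r => ∑ a with φ a = r, α a ^ 2 with hv
  let g : κ → (ι → ℝ) → ℝ := fun r x => (∑ a with φ a = r, α a * x a) ^ 2 - v r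
  have hg : ∀ r, Measurable (g r) := fun r => by
    simp only [g]; fun_prop
  have hgφ : ∀ r x y, (∀ a, φ a = r → x a = y a) → g r x = g r y := by
    intro r x y h
    simp only [g]
    congr 2
    refine Finset.sum_congr rfl fun a ha => ?_
    rw [h a (Finset.mem_filter.1 ha).2]
  have hY : ∀ r, HasSubgaussianMGF (fun ω => ∑ a with φ a = r, α a * w a ω) σ P := by
    intro r
    have hind : iIndepFun (fun a ω => α a * w a ω) P :=
      hw.comp (fun a x => α a * x) fun a => by fun_prop
    refine hasSubgaussianMGF_mono (HasSubgaussianMGF.sum_of_iIndepFun hind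
      (s := Finset.univ.filter fun a => φ a = r) fun a _ => (hsub a).const_mul (α a)) ?_
    rw [← NNReal.coe_le_coe]
    refine le_trans (le_of_eq ?_) (hσc r)
    push_cast
    rw [Finset.sum_mul]
    rfl
  have hbound : ∀ s' : ℝ, |s'| = s →
      Integrable (fun ω => Real.exp (s' * ∑ r, g r (fun a => w a ω))) P ∧
      mgf (fun ω => ∑ r, g r (fun a => w a ω)) P s'
        ≤ Real.exp (256 * Fintype.card κ * (s * σ) ^ 2) := by
    intro s' hs'
    have key : ∀ r, _ := fun r => mgf_sq_sub_le_of_hasSubgaussianMGF hσ (hY r)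
      (integral_sq_sum_of_iIndepFun hw hL2 h0 h1 α _) (hσ1 r) (s := s') (by rw [hs']; exact hs)
    obtain ⟨hi, he⟩ := mgf_sum_fiber_of_iIndepFun hw hm φ g hg hgφ Finset.univ s' fun r => (key r).1
    refine ⟨hi, ?_⟩
    rw [he]
    calc _ ≤ ∏ _r : κ, Real.exp (256 * (s' * σ) ^ 2) :=
          Finset.prod_le_prod (fun _ _ => mgf_nonneg) fun r _ => (key r).2
      _ = _ := by
          rw [Finset.prod_const, ← Real.exp_nat_mul, Finset.card_univ]
          congr 1
          rw [← hs', mul_pow, mul_pow, sq_abs]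
          ring
  have hv_sum : ∑ a, α a ^ 2 = ∑ r, v r := (Finset.sum_fiberwise _ _ _).symm
  have hcenter : ∀ ω, ∑ r, (∑ a with φ a = r, α a * w a ω) ^ 2 - ∑ a, α a ^ 2
      = ∑ r, g r (fun a => w a ω) := fun ω => by
    rw [hv_sum, ← Finset.sum_sub_distrib]
  simp_rw [hcenter]
  have hsplit : {ω | η ≤ |∑ r, g r (fun a => w a ω)|}
      ⊆ {ω | η ≤ ∑ r, g r (fun a => w a ω)} ∪ {ω | ∑ r, g r (fun a => w a ω) ≤ -η} := by
    intro ω hω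
    rcases le_abs.1 (Set.mem_ofPred_eq ▸ hω) with h | h
    · exact Or.inl h
    · exact Or.inr (by simp only [Set.mem_ofPred_eq]; linarith)
  obtain ⟨hi1, hb1⟩ := hbound s (abs_of_nonneg hs0)
  obtain ⟨hi2, hb2⟩ := hbound (-s) (by rw [abs_neg, abs_of_nonneg hs0])
  have hu := measure_ge_le_exp_mul_mgf (μ := P) (X := fun ω => ∑ r, g r (fun a => w a ω)) η hs0 hi1
  have hl := measure_le_le_exp_mul_mgf (μ := P) (X := fun ω => ∑ r, g r (fun a => w a ω)) (-η)
    (neg_nonpos.2 hs0) hi2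
  calc _ ≤ P.real ({ω | η ≤ ∑ r, g r (fun a => w a ω)} ∪
        {ω | ∑ r, g r (fun a => w a ω) ≤ -η}) := measureReal_mono hsplit
    _ ≤ _ := measureReal_union_le _ _
    _ ≤ Real.exp (-s * η) * Real.exp (256 * Fintype.card κ * (s * σ) ^ 2)
        + Real.exp (-s * η) * Real.exp (256 * Fintype.card κ * (s * σ) ^ 2) := by
      refine add_le_add (hu.trans (by gcongr)) (hl.trans ?_)
      rw [show - -s * -η = -s * η by ring]
      gcongr
    _ = _ := by rw [Real.exp_add]; ring

end Groups

/-! ### Nets and near isometries -/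

section Net

variable {E F : Type*} [NormedAddCommGroup E] [InnerProductSpace ℝ E] [FiniteDimensional ℝ E]
  [NormedAddCommGroup F] [InnerProductSpace ℝ F]

/-- A `1/2`-separated subset of the unit ball of maximal cardinality is a `1/2`-net of it. Doubled,
it is `1`-separated in the ball of radius `2`, where at most `5 ^ d` such points fit. -/
lemma exists_half_net_closedBall (E : Type*) [NormedAddCommGroup E] [InnerProductSpace ℝ E]
    [FiniteDimensional ℝ E] :
    ∃ N : Finset E, N.card ≤ 5 ^ Module.finrank ℝ E ∧
      ∀ x : E, ‖x‖ ≤ 1 → ∃ y ∈ N, ‖x - y‖ ≤ 1 / 2 := by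
  classical
  let sep : Finset E → Prop := fun s =>
    (∀ c ∈ s, ‖c‖ ≤ 1) ∧ ∀ c ∈ s, ∀ d ∈ s, c ≠ d → 1 / 2 ≤ ‖c - d‖
  have hcard : ∀ s, sep s → s.card ≤ 5 ^ Module.finrank ℝ E := by
    intro s hs
    have hinj : Function.Injective fun x : E => (2 : ℝ) • x := smul_right_injective E two_ne_zero
    rw [← Finset.card_image_of_injective s hinj]
    refine Besicovitch.card_le_of_separated _ ?_ ?_
    · simp only [Finset.mem_image, forall_exists_index, and_imp, forall_apply_eq_imp_iff₂]
      intro c hc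
      rw [norm_smul, Real.norm_ofNat]
      linarith [hs.1 c hc]
    · simp only [Finset.mem_image, forall_exists_index, and_imp, forall_apply_eq_imp_iff₂]
      intro c hc d hd hcd
      rw [← smul_sub, norm_smul, Real.norm_ofNat]
      linarith [hs.2 c hc d hd fun h => hcd (by rw [h])]
  let p : ℕ → Prop := fun m => ∃ s, sep s ∧ s.card = m
  have hp : p (Nat.findGreatest p (5 ^ Module.finrank ℝ E)) :=
    Nat.findGreatest_spec (Nat.zero_le _) ⟨∅, ⟨by simp, by simp⟩, rfl⟩
  obtain ⟨N, hN, hNcard⟩ := hp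
  refine ⟨N, hcard N hN, fun x hx => ?_⟩
  by_contra! hfar
  have hxN : x ∉ N := fun h => by
    have := hfar x h
    norm_num at this
  have hins : sep (insert x N) := by
    constructor
    · intro c hc
      rcases Finset.mem_insert.1 hc with rfl | hc
      · exact hx
      · exact hN.1 c hc
    · intro c hc d hd hcd
      rcases Finset.mem_insert.1 hc with rfl | hc' <;> rcases Finset.mem_insert.1 hd with rfl | hd'
      · exact absurd rfl hcd
      · exact (hfar d hd').le
      · rw [norm_sub_rev]; exact (hfar c hc').le
      · exact hN.2 c hc' d hd' hcd
  have hle : (insert x N).card ≤ Nat.findGreatest p (5 ^ Module.finrank ℝ E) :=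
    Nat.le_findGreatest (hcard _ hins) ⟨_, hins, rfl⟩
  rw [Finset.card_insert_of_notMem hxN] at hle
  omega

/-- Two successive `1/2`-approximations, the second one of the rescaled error, give a `1/4`-net. -/
lemma exists_quarter_net_closedBall (E : Type*) [NormedAddCommGroup E] [InnerProductSpace ℝ E]
    [FiniteDimensional ℝ E] :
    ∃ N : Finset E, N.card ≤ 25 ^ Module.finrank ℝ E ∧
      ∀ x : E, ‖x‖ ≤ 1 → ∃ y ∈ N, ‖x - y‖ ≤ 1 / 4 := by
  classical
  obtain ⟨N, hcard, hN⟩ := exists_half_net_closedBall E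
  refine ⟨(N ×ˢ N).image fun q => q.1 + (1 / 2 : ℝ) • q.2, ?_, fun x hx => ?_⟩
  · refine Finset.card_image_le.trans ?_
    rw [Finset.card_product, show 25 = 5 * 5 by norm_num, mul_pow]
    exact Nat.mul_le_mul hcard hcard
  · obtain ⟨y, hy, hxy⟩ := hN x hx
    obtain ⟨y', hy', hxy'⟩ := hN ((2 : ℝ) • (x - y)) (by
      rw [norm_smul, Real.norm_ofNat]; linarith)
    refine ⟨y + (1 / 2 : ℝ) • y', Finset.mem_image.2
      ⟨(y, y'), Finset.mk_mem_product hy hy', rfl⟩, ?_⟩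
    have : x - (y + (1 / 2 : ℝ) • y') = (1 / 2 : ℝ) • ((2 : ℝ) • (x - y) - y') := by
      rw [smul_sub, smul_smul]; norm_num; abel
    rw [this, norm_smul, Real.norm_of_nonneg (by norm_num)]
    linarith

/-- A linear map that is nearly isometric on a `1/4`-net of the unit ball is nearly isometric.
With `β` the least distortion, `Q x = ‖L x‖² - ‖x‖²` obeys
`|Q x - Q y| ≤ β ‖x - y‖ ‖x + y‖`, so `β ≤ (5/4)² η + (9/16) β`. -/
lemma abs_norm_sq_sub_le_of_net (L : E →ₗ[ℝ] F) {N : Finset E}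
    (hN : ∀ x : E, ‖x‖ ≤ 1 → ∃ y ∈ N, ‖x - y‖ ≤ 1 / 4) {η : ℝ} (hη0 : 0 ≤ η)
    (hη : ∀ y ∈ N, |‖L y‖ ^ 2 - ‖y‖ ^ 2| ≤ η * ‖y‖ ^ 2) (x : E) :
    |‖L x‖ ^ 2 - ‖x‖ ^ 2| ≤ 4 * η * ‖x‖ ^ 2 := by
  let Q : E → ℝ := fun x => ‖L x‖ ^ 2 - ‖x‖ ^ 2
  have hLc : Continuous L := L.continuous_of_finiteDimensional
  have hQc : Continuous fun x => |Q x| := by fun_prop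
  obtain ⟨x₀, hx₀, hmax⟩ := (isCompact_closedBall (0 : E) 1).exists_isMaxOn
    ⟨0, Metric.mem_closedBall_self zero_le_one⟩ hQc.continuousOn
  set β := |Q x₀| with hβ
  have hβ0 : 0 ≤ β := abs_nonneg _
  have hQsmul : ∀ (t : ℝ) (x : E), Q (t • x) = t ^ 2 * Q x := by
    intro t x
    simp only [Q, map_smul, norm_smul, mul_pow, Real.norm_eq_abs, sq_abs]
    ring
  have hQβ : ∀ x, |Q x| ≤ β * ‖x‖ ^ 2 := by
    intro x
    rcases eq_or_ne x 0 with rfl | hx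
    · simp [Q]
    · have hx' : ‖x‖ ≠ 0 := norm_ne_zero_iff.2 hx
      have h1 : |Q (‖x‖⁻¹ • x)| ≤ β := hmax (by
        rw [mem_closedBall_zero_iff, norm_smul, norm_inv, norm_norm, inv_mul_cancel₀ hx'])
      have h2 : Q x = ‖x‖ ^ 2 * Q (‖x‖⁻¹ • x) := by
        rw [hQsmul, inv_pow, mul_inv_cancel_left₀ (pow_ne_zero 2 hx')]
      rw [h2, abs_mul, abs_of_nonneg (sq_nonneg ‖x‖), mul_comm]
      gcongr
  -- `β` also bounds the symmetric bilinear form of `Q`, here in polarized form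
  have hdiff : ∀ u v : E, |Q (u + v) - Q (u - v)| ≤ 4 * β * ‖u‖ * ‖v‖ := by
    -- polarization is homogeneous, so the two vectors may be rescaled to the same norm
    have hunit : ∀ u v : E, ‖u‖ = 1 → ‖v‖ = 1 → |Q (u + v) - Q (u - v)| ≤ 4 * β := by
      intro u v hu hv
      have hp := parallelogram_law_with_norm ℝ u v
      calc |Q (u + v) - Q (u - v)| ≤ |Q (u + v)| + |Q (u - v)| := abs_sub _ _
        _ ≤ β * ‖u + v‖ ^ 2 + β * ‖u - v‖ ^ 2 := add_le_add (hQβ _) (hQβ _)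
        _ = β * (‖u + v‖ ^ 2 + ‖u - v‖ ^ 2) := by ring
        _ = 4 * β := by rw [hp, hu, hv]; ring
    have hpol : ∀ u v : E, Q (u + v) - Q (u - v) = 4 * (inner ℝ (L u) (L v) - inner ℝ u v) := by
      intro u v
      simp only [Q, map_add, map_sub, norm_add_sq_real, norm_sub_sq_real]
      ring
    intro u v
    rcases eq_or_ne u 0 with rfl | hu
    · rw [hpol]; simp
    rcases eq_or_ne v 0 with rfl | hv
    · simp
    have hu' : ‖u‖ ≠ 0 := norm_ne_zero_iff.2 hu
    have hv' : ‖v‖ ≠ 0 := norm_ne_zero_iff.2 hv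
    have h := hunit (‖u‖⁻¹ • u) (‖v‖⁻¹ • v)
      (by rw [norm_smul, norm_inv, norm_norm, inv_mul_cancel₀ hu'])
      (by rw [norm_smul, norm_inv, norm_norm, inv_mul_cancel₀ hv'])
    have h2 : Q (u + v) - Q (u - v) = ‖u‖ * ‖v‖ *
        (Q (‖u‖⁻¹ • u + ‖v‖⁻¹ • v) - Q (‖u‖⁻¹ • u - ‖v‖⁻¹ • v)) := by
      rw [hpol, hpol]
      simp only [map_smul, real_inner_smul_left, real_inner_smul_right]
      field_simp
    rw [h2, abs_mul, abs_of_nonneg (by positivity)]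
    calc _ ≤ ‖u‖ * ‖v‖ * (4 * β) := by gcongr
      _ = _ := by ring
  have hβη : β ≤ 4 * η := by
    have hx₀' : ‖x₀‖ ≤ 1 := mem_closedBall_zero_iff.1 hx₀
    obtain ⟨y, hy, hxy⟩ := hN x₀ hx₀'
    have hy1 : ‖y‖ ≤ 5 / 4 := by
      have := norm_sub_norm_le y x₀
      rw [norm_sub_rev] at this
      linarith
    have hsum : ‖x₀ + y‖ ≤ 9 / 4 := (norm_add_le _ _).trans (by linarith)
    have h1 : |Q x₀ - Q y| ≤ 9 / 16 * β := by
      have h := hdiff ((1 / 2 : ℝ) • (x₀ + y)) ((1 / 2 : ℝ) • (x₀ - y))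
      rw [← smul_add, ← smul_sub, show x₀ + y + (x₀ - y) = (2 : ℝ) • x₀ by rw [two_smul]; abel,
        show x₀ + y - (x₀ - y) = (2 : ℝ) • y by rw [two_smul]; abel, smul_smul, smul_smul,
        norm_smul, norm_smul] at h
      norm_num at h
      calc |Q x₀ - Q y| ≤ β * (‖x₀ + y‖ * ‖x₀ - y‖) := by linarith
        _ ≤ β * (9 / 4 * (1 / 4)) := by gcongr
        _ = 9 / 16 * β := by ring
    have h2 : |Q y| ≤ η * ‖y‖ ^ 2 := hη y hy
    have h3 : β ≤ |Q y| + |Q x₀ - Q y| := by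
      have := abs_add_le (Q y) (Q x₀ - Q y)
      rwa [add_sub_cancel] at this
    have : η * ‖y‖ ^ 2 ≤ η * (5 / 4) ^ 2 := by gcongr
    linarith
  exact (hQβ x).trans (by gcongr)

end Net

/-! ### The transposed CNN matrix on a model vector -/

section CNN

variable {K M D ℓ t n : ℕ}

/-- The position in `Fin M × Fin D` at which the filter entry `(i, m, a)` appears when the `i`-th
filter is shifted by `J i` strides. Each filter entry is used at one position only, which is what
makes the coordinates of `Wᵀ z` independent for `z` in the model. -/
def filterPosition (hD : ∀ (j : Fin n) (a : Fin ℓ), j.val * t + a.val < D) (J : Fin K → Fin n)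
    (x : Fin K × Fin M × Fin ℓ) : Fin M × Fin D :=
  (x.2.1, ⟨(J x.1).val * t + x.2.2.val, hD _ _⟩)

lemma sum_filterPosition_fiber (hD : ∀ (j : Fin n) (a : Fin ℓ), j.val * t + a.val < D)
    (J : Fin K → Fin n) (u : Fin K → ℝ) (f : Fin K → Fin M → Fin ℓ → ℝ) (r : Fin M × Fin D) :
    ∑ x with filterPosition hD J x = r, u x.1 * f x.1 x.2.1 x.2.2
      = ∑ i, u i * cnnMatrix n D t f (i, J i) r := by
  obtain ⟨m, d⟩ := r
  rw [Finset.sum_filter, Fintype.sum_prod_type]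
  refine Finset.sum_congr rfl fun i _ => ?_
  rw [Fintype.sum_prod_type, Finset.sum_eq_single m]
  · simp only [filterPosition, Prod.mk.injEq, true_and, cnnMatrix]
    split_ifs with h
    · rw [Finset.sum_eq_single ⟨d.val - (J i).val * t, h.2⟩]
      · rw [if_pos]
        exact Fin.ext (Nat.add_sub_cancel' h.1)
      · intro a _ ha
        rw [if_neg]
        intro hd
        apply ha
        have := congrArg Fin.val hd
        ext
        simp only at this ⊢
        omega
      · simp
    · rw [mul_zero]
      refine Finset.sum_eq_zero fun a _ => if_neg fun hd => h ?_
      have := congrArg Fin.val hd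
      have ha := a.isLt
      simp only at this
      omega
  · intro m' _ hm
    refine Finset.sum_eq_zero fun a _ => if_neg fun h => hm ?_
    exact congrArg Prod.fst h
  · simp

lemma sum_eq_sum_of_blockSparse {z : Fin K × Fin n → ℝ} {J : Fin K → Fin n}
    (hJ : ∀ i j, z (i, j) ≠ 0 → j = J i) (g : Fin K × Fin n → ℝ) (hg : ∀ p, z p = 0 → g p = 0) :
    ∑ p, g p = ∑ i, g (i, J i) := by
  rw [Fintype.sum_prod_type]
  refine Finset.sum_congr rfl fun i _ => Finset.sum_eq_single (J i) (fun j _ hj => ?_) (by simp)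
  exact hg _ (by_contra fun h => hj (hJ i j h))

/-- A vector with at most one nonzero entry in each block selects a shift of every filter. -/
lemma exists_shift_of_blockSparse (hn : 0 < n) {z : Fin K × Fin n → ℝ}
    (hz : ∀ i j j', z (i, j) ≠ 0 → z (i, j') ≠ 0 → j = j') :
    ∃ J : Fin K → Fin n, ∀ i j, z (i, j) ≠ 0 → j = J i := by
  have : ∀ i, ∃ j₀, ∀ j, z (i, j) ≠ 0 → j = j₀ := by
    intro i
    by_cases h : ∃ j, z (i, j) ≠ 0
    · obtain ⟨j₀, h₀⟩ := h
      exact ⟨j₀, fun j hj => hz i j j₀ hj h₀⟩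
    · push Not at h
      exact ⟨⟨0, hn⟩, fun j hj => absurd (h j) hj⟩
  choose J hJ using this
  exact ⟨J, hJ⟩

/-- The CNN matrix whose filters are the vectors `w (i, m, ·)` scaled by `1 / √(M ℓ)`. -/
noncomputable abbrev scaledCNNMatrix (n D t : ℕ) (w : Fin K × Fin M × Fin ℓ → ℝ) :
    Matrix (Fin K × Fin n) (Fin M × Fin D) ℝ :=
  cnnMatrix n D t (fun i m a => (1 / Real.sqrt ((M : ℝ) * (ℓ : ℝ))) * w (i, m, a))

/-- Concentration of `‖Wᵀ z‖²` around `‖z‖²` for a fixed block-sparse `z`. -/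
lemma measure_rip_fails_le (hM : 0 < M) (hℓ : 0 < ℓ) (hℓD : ℓ ≤ D) (hn : 0 < n)
    (hD : ∀ (j : Fin n) (a : Fin ℓ), j.val * t + a.val < D)
    {Ω : Type*} [MeasurableSpace Ω] {P : Measure Ω} [IsProbabilityMeasure P]
    {w : Fin K × Fin M × Fin ℓ → Ω → ℝ} {b : ℝ≥0} (hb : 1 ≤ b) (hw : iIndepFun w P)
    (h0 : ∀ a, ∫ ω, w a ω ∂P = 0) (h1 : ∀ a, variance (w a) P = 1)
    (hsub : ∀ a, HasSubgaussianMGF (w a) b P) {η : ℝ} (hη0 : 0 ≤ η) (hη1 : η ≤ 1)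
    (z : EuclideanSpace ℝ (Fin K × Fin n))
    (hz : ∀ i j j', z (i, j) ≠ 0 → z (i, j') ≠ 0 → j = j') :
    P.real {ω | ¬ |‖Matrix.toLpLin 2 2 (scaledCNNMatrix n D t (fun a => w a ω))ᵀ z‖ ^ 2 - ‖z‖ ^ 2|
        ≤ η * ‖z‖ ^ 2}
      ≤ 2 * Real.exp (-(η ^ 2 * ((M : ℝ) * (ℓ : ℝ) ^ 2 / (D : ℝ)) / (1024 * b ^ 2))) := by
  rcases eq_or_ne z 0 with rfl | hz0
  · simp
    positivity
  obtain ⟨J, hJ⟩ := exists_shift_of_blockSparse hn hz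
  have hzpos : 0 < ‖z‖ ^ 2 := by positivity
  have hMr : (0 : ℝ) < M := Nat.cast_pos.2 hM
  have hℓr : (0 : ℝ) < ℓ := Nat.cast_pos.2 hℓ
  have hDr : (0 : ℝ) < D := Nat.cast_pos.2 (hℓ.trans_le hℓD)
  have hℓDr : (ℓ : ℝ) ≤ D := Nat.cast_le.2 hℓD
  have hb' : (1 : ℝ) ≤ b := hb
  have hMℓ : (0 : ℝ) < M * ℓ := by positivity
  set q : ℝ := 1 / Real.sqrt ((M : ℝ) * ℓ) with hq
  have hq2 : q ^ 2 = 1 / (M * ℓ) := by rw [hq, div_pow, one_pow, Real.sq_sqrt hMℓ.le]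
  have hnorm : ‖z‖ ^ 2 = ∑ i, z (i, J i) ^ 2 := by
    rw [EuclideanSpace.real_norm_sq_eq]
    exact sum_eq_sum_of_blockSparse hJ (fun p => z p ^ 2) fun p hp => by simp [hp]
  let α : Fin K × Fin M × Fin ℓ → ℝ := fun x => z (x.1, J x.1) * q
  -- the coordinates of `Wᵀ z` are linear forms in disjoint groups of the filter entries
  have hcoord : ∀ ω, ‖Matrix.toLpLin 2 2 (scaledCNNMatrix n D t (fun a => w a ω))ᵀ z‖ ^ 2
      = ∑ r, (∑ x with filterPosition hD J x = r, α x * w x ω) ^ 2 := by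
    intro ω
    rw [EuclideanSpace.real_norm_sq_eq]
    refine Finset.sum_congr rfl fun r _ => ?_
    congr 1
    have h2 := sum_filterPosition_fiber hD J (fun i => z (i, J i))
      (fun i m a => q * w (i, m, a) ω) r
    calc _ = ∑ p, scaledCNNMatrix n D t (fun a => w a ω) p r * z p := rfl
      _ = ∑ i, scaledCNNMatrix n D t (fun a => w a ω) (i, J i) r * z (i, J i) :=
        sum_eq_sum_of_blockSparse hJ _ fun p hp => by rw [hp, mul_zero]
      _ = ∑ i, z (i, J i) * scaledCNNMatrix n D t (fun a => w a ω) (i, J i) r :=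
        Finset.sum_congr rfl fun i _ => mul_comm _ _
      _ = _ := h2.symm
      _ = _ := Finset.sum_congr rfl fun x _ => by simp only [α]; ring
  have hmean : ∑ x, α x ^ 2 = ‖z‖ ^ 2 := by
    rw [hnorm, Fintype.sum_prod_type]
    refine Finset.sum_congr rfl fun i _ => ?_
    simp only [α, mul_pow, hq2, Finset.sum_const, Finset.card_univ, Fintype.card_prod,
      Fintype.card_fin, nsmul_eq_mul, Nat.cast_mul]
    field_simp
  have hfib : ∀ r, ∑ x with filterPosition hD J x = r, α x ^ 2 ≤ ‖z‖ ^ 2 / (M * ℓ) := by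
    intro r
    have h2 := sum_filterPosition_fiber hD J (fun i => z (i, J i) ^ 2)
      (fun (_ : Fin K) (_ : Fin M) (_ : Fin ℓ) => 1 / ((M : ℝ) * ℓ)) r
    calc _ = _ := Finset.sum_congr rfl fun x _ => by simp only [α, mul_pow, hq2]
      _ = _ := h2
      _ ≤ ∑ i, z (i, J i) ^ 2 * (1 / ((M : ℝ) * ℓ)) := by
        refine Finset.sum_le_sum fun i _ => mul_le_mul_of_nonneg_left ?_ (sq_nonneg _)
        rw [cnnMatrix]
        split_ifs
        · exact le_rfl
        · positivity
      _ = _ := by rw [← Finset.sum_mul, ← hnorm]; ring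
  let σ : ℝ≥0 := b * ⟨‖z‖ ^ 2 / (M * ℓ), by positivity⟩
  have hσ_eq : (σ : ℝ) = b * (‖z‖ ^ 2 / (M * ℓ)) := rfl
  have hσ : 0 < σ := by
    rw [← NNReal.coe_pos, hσ_eq]; positivity
  -- the value of `s` that optimizes the Chernoff bound
  set R : ℝ := (M : ℝ) * (ℓ : ℝ) ^ 2 / (D : ℝ) with hR
  have hR0 : 0 < R := by positivity
  have hRle : R ≤ M * ℓ := by
    rw [hR, div_le_iff₀ hDr]
    nlinarith
  set s : ℝ := η * R / (512 * b ^ 2 * ‖z‖ ^ 2) with hs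
  have hsσ : s * σ = η * R / (512 * b * (M * ℓ)) := by
    rw [hs, hσ_eq]; field_simp
  have hmain := measure_abs_sum_sq_sub_ge_le hw hsub h0 h1 (filterPosition hD J) α hσ
    (fun r => (hfib r).trans (by
      rw [hσ_eq]; exact le_mul_of_one_le_left (by positivity) hb'))
    (fun r => by
      rw [hσ_eq, mul_comm (b : ℝ)]; exact mul_le_mul_of_nonneg_right (hfib r) b.coe_nonneg)
    (s := s) (η := η * ‖z‖ ^ 2) (by positivity) (by
      rw [hsσ, div_le_div_iff₀ (by positivity) (by norm_num)]
      have : η * R ≤ 1 * (M * ℓ) := by gcongr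
      nlinarith)
  have hexp : -s * (η * ‖z‖ ^ 2) + 256 * Fintype.card (Fin M × Fin D) * (s * σ) ^ 2
      = -(η ^ 2 * R / (1024 * b ^ 2)) := by
    rw [hsσ, Fintype.card_prod, Fintype.card_fin, Fintype.card_fin, hs, hR]
    push_cast
    field_simp
    ring
  rw [hexp] at hmain
  refine (measureReal_mono ?_).trans hmain
  intro ω hω
  simp only [Set.mem_ofPred_eq, not_le] at hω ⊢
  rw [← hcoord, hmean]
  exact hω.le

/-! ### Subspaces of sparse vectors -/

/-- The vectors supported on the range of `p`, as the span of the corresponding basis vectors. -/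
noncomputable def supportedOn {ι : Type*} {k : ℕ} [Fintype ι] [DecidableEq ι] (p : Fin k → ι) :
    Submodule ℝ (EuclideanSpace ℝ ι) :=
  Submodule.span ℝ (Set.range fun q => EuclideanSpace.single (p q) (1 : ℝ))

section SupportedOn

variable {ι : Type*} {k : ℕ} [Fintype ι]

/-- Repetitions in `p` are allowed, so that supports of every size from `1` to `k` occur. -/
lemma exists_range_eq_support {z : EuclideanSpace ℝ ι} (hz : z ≠ 0)
    (hk : {x | z x ≠ 0}.ncard ≤ k) : ∃ p : Fin k → ι, Set.range p = {x | z x ≠ 0} := by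
  have hne : Nonempty {x | z x ≠ 0} := by
    by_contra h
    refine hz ?_
    ext x
    by_contra hx
    exact h ⟨⟨x, hx⟩⟩
  have : Fintype {x | z x ≠ 0} := Fintype.ofFinite _
  obtain ⟨e⟩ := Function.Embedding.nonempty_of_card_le (α := {x | z x ≠ 0}) (β := Fin k) (by
    rwa [Fintype.card_fin, ← Nat.card_eq_fintype_card])
  refine ⟨Subtype.val ∘ Function.invFun e, ?_⟩
  rw [Set.range_comp, (Function.invFun_surjective e.injective).range_eq, Set.image_univ,
    Subtype.range_coe]

variable [DecidableEq ι]

lemma finrank_supportedOn_le (p : Fin k → ι) : Module.finrank ℝ (supportedOn p) ≤ k :=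
  (finrank_range_le_card _).trans_eq (Fintype.card_fin k)

lemma mem_range_of_mem_supportedOn {p : Fin k → ι} {z : EuclideanSpace ℝ ι}
    (hz : z ∈ supportedOn p) {x : ι} (hx : z x ≠ 0) : x ∈ Set.range p := by
  by_contra hxp
  apply hx
  refine Submodule.span_induction ?_ rfl ?_ ?_ hz
  · rintro _ ⟨q, rfl⟩
    have : x ≠ p q := fun h => hxp ⟨q, h.symm⟩
    simp [this]
  · intro u v _ _ hu hv
    simp [hu, hv]
  · intro a u _ hu
    simp [hu]

lemma mem_supportedOn_of_support_subset {p : Fin k → ι} {z : EuclideanSpace ℝ ι}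
    (hz : ∀ x, z x ≠ 0 → x ∈ Set.range p) : z ∈ supportedOn p := by
  have hsum : z = ∑ x, z x • EuclideanSpace.single x (1 : ℝ) := by
    ext y
    simp [Finset.sum_apply, Pi.single_apply]
  rw [hsum]
  refine Submodule.sum_mem _ fun x _ => ?_
  by_cases hx : z x = 0
  · simp [hx]
  · obtain ⟨q, hq⟩ := hz x hx
    exact Submodule.smul_mem _ _ (Submodule.subset_span ⟨q, by simp [hq]⟩)

end SupportedOn

end CNN

/-! ### The union bound -/

theorem theorem1 (c : ℝ≥0) :
    ∃ C : ℝ, 0 < C ∧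
      ∀ (K M D ℓ t n k : ℕ) (δ ε : ℝ),
        0 < M → 0 < ℓ → ℓ ≤ D → 0 < t → (n : ℝ) = ((D : ℝ) - (ℓ : ℝ)) / (t : ℝ) + 1 →
        2 ≤ K * n → 0 < δ → δ < 1 → 0 < ε → ε < 1 →
        C / δ ^ 2 * ((k : ℝ) * (Real.log K + Real.log n) - Real.log ε)
          ≤ (M : ℝ) * (ℓ : ℝ) ^ 2 / (D : ℝ) →
        ∀ (Ω : Type*) [MeasurableSpace Ω] (P : Measure Ω) [IsProbabilityMeasure P]
          (w : Fin K × Fin M × Fin ℓ → Ω → ℝ),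
          iIndepFun w P →
          (∀ a b, IdentDistrib (w a) (w b) P P) →
          (∀ a, ∫ ω, w a ω ∂P = 0) →
          (∀ a, variance (w a) P = 1) →
          (∀ a, HasSubgaussianMGF (w a) c P) →
          1 - ε ≤ P.real {ω | ModelRIP
            (cnnMatrix n D t
              (fun i m a => (1 / Real.sqrt ((M : ℝ) * (ℓ : ℝ))) * w (i, m, a) ω))ᵀ k δ} := by
  classical
  set b : ℝ≥0 := max c 1 with hbdef
  have hb : 1 ≤ b := le_max_right _ _
  have hb' : (1 : ℝ) ≤ b := hb
  -- `16384 = 4² * 1024`, since the net is tested at distortion `δ / 4`; the factor `7 = 1 + 1 + 5`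
  -- collects `k log (K n)`, `log 2 ≤ k log (K n)` and `k log 25 ≤ 5 k log (K n)`
  refine ⟨7 * (16384 * b ^ 2), by positivity, ?_⟩
  intro K M D ℓ t n k δ ε hM hℓ hℓD ht hn hKn hδ0 hδ1 hε0 hε1 hC Ω _ P _ w hw _ h0 h1 hsub
  have hsub' : ∀ a, HasSubgaussianMGF (w a) b P := fun a =>
    hasSubgaussianMGF_mono (hsub a) (le_max_left _ _)
  have hKn0 : 0 < K * n := by omega
  have hK0 : 0 < K := Nat.pos_of_mul_pos_right hKn0
  have hn0 : 0 < n := Nat.pos_of_mul_pos_left hKn0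
  have hD : ∀ (j : Fin n) (a : Fin ℓ), j.val * t + a.val < D := by
    intro j a
    have htr : (t : ℝ) ≠ 0 := by positivity
    have hreal : (n : ℝ) * t + ℓ = D + t := by
      rw [hn]; field_simp; ring
    have hnat : n * t + ℓ = D + t := by exact_mod_cast hreal
    have hj : (j.val + 1) * t ≤ n * t := Nat.mul_le_mul_right t j.isLt
    have ha := a.isLt
    rw [add_mul, one_mul] at hj
    omega
  set Φ : Ω → Matrix (Fin M × Fin D) (Fin K × Fin n) ℝ :=
    fun ω => (scaledCNNMatrix n D t (fun a => w a ω))ᵀ with hΦ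
  have hgoal : ∀ ω, ModelRIP (Φ ω) k δ ↔ ∀ z ∈ modelSparse K n k,
      |‖Matrix.toLpLin 2 2 (Φ ω) z‖ ^ 2 - ‖z‖ ^ 2| ≤ δ * ‖z‖ ^ 2 := by
    intro ω
    refine forall₂_congr fun z _ => ?_
    rw [abs_le, Matrix.toLpLin_apply]
    constructor <;> rintro ⟨h2, h3⟩ <;> constructor <;> linarith
  change 1 - ε ≤ P.real {ω | ModelRIP (Φ ω) k δ}
  -- the supports of the nonzero model vectors, enumerated with repetition
  let G : Finset (Fin k → Fin K × Fin n) :=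
    Finset.univ.filter fun p => ∀ q q', (p q).1 = (p q').1 → p q = p q'
  choose N hNcard hN using fun p : Fin k → Fin K × Fin n =>
    exists_quarter_net_closedBall (supportedOn p)
  let bad : EuclideanSpace ℝ (Fin K × Fin n) → Set Ω := fun z =>
    {ω | ¬ |‖Matrix.toLpLin 2 2 (Φ ω) z‖ ^ 2 - ‖z‖ ^ 2| ≤ δ / 4 * ‖z‖ ^ 2}
  have hcover : {ω | ModelRIP (Φ ω) k δ}ᶜ ⊆ ⋃ p ∈ G, ⋃ u ∈ N p, bad u := by
    intro ω hω
    by_contra hnot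
    refine hω ((hgoal ω).2 fun z hz => ?_)
    rcases eq_or_ne z 0 with rfl | hz0
    · simp
    obtain ⟨p, hp⟩ := exists_range_eq_support hz0 hz.2
    have hpG : p ∈ G := by
      refine Finset.mem_filter.2 ⟨Finset.mem_univ _, fun q q' hqq => Prod.ext hqq ?_⟩
      have hmem : ∀ q, z (p q) ≠ 0 := fun q => by
        have : p q ∈ {x | z x ≠ 0} := hp ▸ Set.mem_range_self q
        exact this
      refine hz.1 (p q).1 _ _ (hmem q) ?_
      rw [hqq]
      exact hmem q'
    have hzV : z ∈ supportedOn p := mem_supportedOn_of_support_subset fun x hx => by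
      rw [hp]; exact hx
    have hnet := abs_norm_sq_sub_le_of_net
      ((Matrix.toLpLin 2 2 (Φ ω)).comp (supportedOn p).subtype) (hN p) (η := δ / 4)
      (by positivity) (fun u hu => by
        by_contra hu'
        exact hnot (Set.mem_biUnion hpG (Set.mem_biUnion hu hu'))) ⟨z, hzV⟩
    have h4 : 4 * (δ / 4) = δ := by ring
    rw [h4] at hnet
    exact hnet
  set R : ℝ := (M : ℝ) * (ℓ : ℝ) ^ 2 / (D : ℝ) with hR
  set T : ℝ := (δ / 4) ^ 2 * R / (1024 * b ^ 2) with hT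
  have hbad : ∀ p ∈ G, ∀ u ∈ N p, P.real (bad u) ≤ 2 * Real.exp (-T) := by
    intro p hp u _
    refine measure_rip_fails_le hM hℓ hℓD hn0 hD hb hw h0 h1 hsub' (by positivity)
      (by linarith) (u : EuclideanSpace ℝ (Fin K × Fin n)) fun i j j' hj hj' => ?_
    obtain ⟨q, hq⟩ := mem_range_of_mem_supportedOn u.2 hj
    obtain ⟨q', hq'⟩ := mem_range_of_mem_supportedOn u.2 hj'
    have := (Finset.mem_filter.1 hp).2 q q' (by rw [hq, hq'])
    rw [hq, hq'] at this
    exact congrArg Prod.snd this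
  have hfail : P.real {ω | ModelRIP (Φ ω) k δ}ᶜ
      ≤ (K * n : ℝ) ^ k * (25 ^ k * (2 * Real.exp (-T))) := by
    calc _ ≤ P.real (⋃ p ∈ G, ⋃ u ∈ N p, bad u) := measureReal_mono hcover (measure_ne_top _ _)
      _ ≤ ∑ p ∈ G, P.real (⋃ u ∈ N p, bad u) := measureReal_biUnion_finset_le _ _
      _ ≤ ∑ p ∈ G, (25 ^ k * (2 * Real.exp (-T))) := by
        refine Finset.sum_le_sum fun p hp => ?_
        calc _ ≤ ∑ u ∈ N p, P.real (bad u) := measureReal_biUnion_finset_le _ _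
          _ ≤ ∑ u ∈ N p, 2 * Real.exp (-T) := Finset.sum_le_sum (hbad p hp)
          _ = (N p).card * (2 * Real.exp (-T)) := by rw [Finset.sum_const, nsmul_eq_mul]
          _ ≤ _ := by
            gcongr
            have h2 : (N p).card ≤ 25 ^ k := (hNcard p).trans
              (Nat.pow_le_pow_right (by norm_num) (finrank_supportedOn_le p))
            exact_mod_cast h2
      _ = G.card * (25 ^ k * (2 * Real.exp (-T))) := by rw [Finset.sum_const, nsmul_eq_mul]
      _ ≤ _ := by
        gcongr
        have h2 : G.card ≤ (K * n) ^ k := (Finset.card_le_univ _).trans_eq (by simp)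
        exact_mod_cast h2
  have hfail' : P.real {ω | ModelRIP (Φ ω) k δ}ᶜ ≤ ε := by
    rcases Nat.eq_zero_or_pos k with rfl | hk
    · -- the model is `{0}`, and no probability estimate is needed
      have hempty : {ω | ModelRIP (Φ ω) 0 δ}ᶜ = ∅ := by
        rw [Set.compl_empty_iff, Set.eq_univ_iff_forall]
        intro ω
        refine (hgoal ω).2 fun z hz => ?_
        have hz0 : z = 0 := by
          by_contra hne
          obtain ⟨p, hp⟩ := exists_range_eq_support hne hz.2
          refine hne ?_
          ext x
          by_contra hx
          have : x ∈ Set.range p := by rw [hp]; exact hx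
          obtain ⟨q, _⟩ := this
          exact q.elim0
        simp [hz0]
      rw [hempty]
      simpa using hε0.le
    · refine hfail.trans ?_
      have hKr : (0 : ℝ) < K := Nat.cast_pos.2 hK0
      have hnr : (0 : ℝ) < n := Nat.cast_pos.2 hn0
      have hkr : (1 : ℝ) ≤ k := Nat.one_le_cast.2 hk
      have hlogKn : Real.log K + Real.log n = Real.log (K * n) :=
        (Real.log_mul hKr.ne' hnr.ne').symm
      have h2Kn : (2 : ℝ) ≤ K * n := by exact_mod_cast hKn
      set lam : ℝ := Real.log (K * n) with hlam
      have hlog2 : Real.log 2 ≤ lam := Real.log_le_log (by norm_num) h2Kn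
      have hlog25 : Real.log 25 ≤ 5 * lam := by
        calc Real.log 25 ≤ Real.log (2 ^ 5) := Real.log_le_log (by norm_num) (by norm_num)
          _ = 5 * Real.log 2 := by rw [Real.log_pow]; norm_num
          _ ≤ 5 * lam := by linarith
      have hlam0 : 0 ≤ lam := (Real.log_nonneg (by norm_num)).trans hlog2
      have hlogε : Real.log ε < 0 := Real.log_neg hε0 hε1
      have hTlow : 7 * (k * lam - Real.log ε) ≤ T := by
        rw [hlogKn] at hC
        have hTR : T = δ ^ 2 / (16384 * b ^ 2) * R := by
          rw [hT]; field_simp; ring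
        rw [hTR]
        calc _ = δ ^ 2 / (16384 * b ^ 2) *
              (7 * (16384 * b ^ 2) / δ ^ 2 * (k * lam - Real.log ε)) := by field_simp
          _ ≤ _ := by gcongr
      have hlog : Real.log ((K * n : ℝ) ^ k * (25 ^ k * (2 * Real.exp (-T)))) ≤ Real.log ε := by
        rw [Real.log_mul (by positivity) (by positivity),
          Real.log_mul (by positivity) (by positivity),
          Real.log_mul (by positivity) (by positivity), Real.log_exp, Real.log_pow, Real.log_pow]
        have h25 : (k : ℝ) * Real.log 25 ≤ 5 * (k * lam) := by nlinarith
        have h2 : Real.log 2 ≤ k * lam := by nlinarith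
        linarith
      exact (Real.log_le_log_iff (by positivity) hε0).1 hlog
  -- subadditivity of `P` suffices here: no measurability of the event is needed
  have htotal : 1 ≤ P.real {ω | ModelRIP (Φ ω) k δ} + P.real {ω | ModelRIP (Φ ω) k δ}ᶜ := by
    have := measureReal_union_le (μ := P) {ω | ModelRIP (Φ ω) k δ} {ω | ModelRIP (Φ ω) k δ}ᶜ
    rwa [Set.union_compl_self, probReal_univ] at this
  linarith
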